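/- A group with triality is a pair $(G,S)$ where $G$ is a (possibly infinite) group, $S\le\mathrm{Aut}(G)$ is generated by automorphisms $\sigma,\rho$ with $\sigma^2=\rho^3=(\sigma\rho)^2=1$ and $S\cong S_3$ (the symmetric group on three letters), and $$[g,\sigma]\,[g,\sigma]^{\rho}\,[g,\sigma]^{\rho^2}=1\qquad\text{for all } g\in G,$$ where $g^\alpha$ denotes the image of $g$ under $\alpha\in\mathrm{Aut}(G)$ and $[g,\sigma]=g^{-1}g^\sigma$. It is called $S$-simple if the only $S$-invariant normal subgroups of $G$ are $\{1\}$ and $G$. **Proposition.** Let $(G,S)$, with $S=\langle\sigma,\rho\rangle$ as above, be an $S$-simple group with triality such that $G$ is noncommutative. Then either $G$ is a simple group, or there are a simple group $A$ and an isomorphism identifying $G$ with $A\times A\times A$ under which the triality automorphisms are given by $$(a,b,c)^\rho=(c,a,b),\qquad (a,b,c)^\sigma=(a,c,b)\qquad (a,b,c\in A).$$ -/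

import Mathlib

universe u

/-- `(G, S)` is a group with triality, with triality automorphisms `σ` and `ρ`: `S` is the group of
automorphisms of `G` generated by `σ` and `ρ`, it is a copy of the symmetric group of degree three
with `σ ^ 2 = ρ ^ 3 = (σρ) ^ 2 = 1`, and the triality identity
`[g,σ] [g,σ]^ρ [g,σ]^(ρ^2) = 1` holds, where `[g,σ] = g⁻¹ g^σ` and `g^α` is `α g`.
Automorphisms act from the right in the usual notation, so that `σρ` (first `σ`, then `ρ`) is
`ρ * σ` in `MulAut G`. -/
structure IsGroupWithTriality (G : Type u) [Group G] (S : Subgroup (MulAut G))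
    (σ ρ : MulAut G) : Prop where
  closure_eq : Subgroup.closure {σ, ρ} = S
  sigma_sq : σ ^ 2 = 1
  rho_cube : ρ ^ 3 = 1
  sigma_rho_sq : (ρ * σ) ^ 2 = 1
  equiv_perm : Nonempty (S ≃* Equiv.Perm (Fin 3))
  triality : ∀ g : G, (g⁻¹ * σ g) * ρ (g⁻¹ * σ g) * (ρ ^ 2) (g⁻¹ * σ g) = 1

/-- `G` is `S`-simple: the only normal subgroups of `G` invariant under `S` are `1` and `G`. -/
def IsSSimple (G : Type u) [Group G] (S : Subgroup (MulAut G)) : Prop :=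
  ∀ N : Subgroup G, N.Normal → (∀ s ∈ S, ∀ n ∈ N, s n ∈ N) → N = ⊥ ∨ N = ⊤

section

open scoped Pointwise

variable {G : Type u} [Group G]

/-! The centre is `S`-invariant, hence trivial, so an element centralizing a family of generating
subgroups is 1; normal subgroups meeting trivially commute. Suppose `G` has a proper nontrivial
normal subgroup.

Some such subgroup is `σ`-invariant. Otherwise every such `P` gives `G = P × σP`, which forces `N`
to be `ρ`-invariant. Triality then reads `g · ρ g · ρ² g = 1` on `N`, and this identity produces a
nontrivial central element (`not_isCompl_of_rho_invariant`).

Intersecting conjugates yields a `σ`-invariant `L` with `L ∩ ρL = 1`. By `S`-simplicity and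
triviality of the centre, `G = L × ρL × ρ²L`; triality makes `σ` trivial on `L`, which determines
the action, and `S`-simplicity makes `L` simple. -/

theorem Subgroup.smul_normal_of_mulAut (α : MulAut G) {N : Subgroup G} (hN : N.Normal) :
    (α • N).Normal := by
  refine ⟨fun n hn g => ?_⟩
  rw [Subgroup.mem_pointwise_smul_iff_inv_smul_mem] at hn ⊢
  simp only [MulAut.smul_def, map_mul, map_inv] at hn ⊢
  exact hN.conj_mem _ hn _

theorem Subgroup.apply_mem_smul (α : MulAut G) {N : Subgroup G} {n : G} (hn : n ∈ N) :
    α n ∈ α • N :=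
  Subgroup.smul_mem_pointwise_smul n α N hn

theorem Subgroup.eq_one_of_mul_eq_one_of_inf_eq_bot {A B : Subgroup G} (h : A ⊓ B = ⊥) {a b : G}
    (ha : a ∈ A) (hb : b ∈ B) (hab : a * b = 1) : a = 1 := by
  have : a ∈ A ⊓ B := ⟨ha, by rw [eq_inv_of_mul_eq_one_left hab]; exact B.inv_mem hb⟩
  rwa [h, Subgroup.mem_bot] at this

theorem Subgroup.commute_of_normal_of_inf_eq_bot {A B : Subgroup G} (hA : A.Normal)
    (hB : B.Normal) (h : A ⊓ B = ⊥) {a b : G} (ha : a ∈ A) (hb : b ∈ B) : Commute a b :=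
  Subgroup.commute_of_normal_of_disjoint A B hA hB (disjoint_iff.2 h) a b ha hb

/-- In a group with trivial centre, an element commuting with two subgroups that generate the
whole group is trivial. -/
theorem Subgroup.eq_one_of_commute_of_sup_eq_top (hZ : Subgroup.center G = ⊥)
    {A B : Subgroup G} (hAB : A ⊔ B = ⊤) {g : G} (hA : ∀ a ∈ A, Commute g a)
    (hB : ∀ b ∈ B, Commute g b) : g = 1 := by
  have h : A ⊔ B ≤ Subgroup.centralizer {g} :=
    sup_le (fun a ha => Subgroup.mem_centralizer_singleton_iff.2 (hA a ha).eq.symm)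
      (fun b hb => Subgroup.mem_centralizer_singleton_iff.2 (hB b hb).eq.symm)
  rw [hAB] at h
  have : g ∈ Subgroup.center G := Subgroup.mem_center_iff.2 fun x =>
    Subgroup.mem_centralizer_singleton_iff.1 (h (Subgroup.mem_top x))
  rwa [hZ, Subgroup.mem_bot] at this

variable {S : Subgroup (MulAut G)} {σ ρ : MulAut G}

namespace IsGroupWithTriality

/-! ### Relations of the symmetric group, on elements and on subgroups -/

theorem sigma_sigma (hT : IsGroupWithTriality G S σ ρ) : σ * σ = 1 := by
  rw [← sq, hT.sigma_sq]

theorem rho_rho_rho (hT : IsGroupWithTriality G S σ ρ) : ρ * (ρ * ρ) = 1 := by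
  rw [← hT.rho_cube, pow_succ', sq]

theorem sigma_rho (hT : IsGroupWithTriality G S σ ρ) : σ * ρ = ρ * ρ * σ := by
  have h1 := hT.sigma_rho_sq
  have h2 := hT.rho_rho_rho
  have h3 := hT.sigma_sigma
  rw [sq] at h1
  calc σ * ρ = (ρ * (ρ * ρ)) * (σ * ρ) * (σ * σ) := by rw [h2, h3, one_mul, mul_one]
    _ = ρ * ρ * (ρ * σ * (ρ * σ)) * σ := by group
    _ = ρ * ρ * σ := by rw [h1, mul_one]

theorem sigma_rho_rho (hT : IsGroupWithTriality G S σ ρ) : σ * (ρ * ρ) = ρ * σ := by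
  have h2 := hT.rho_rho_rho
  calc σ * (ρ * ρ) = (σ * ρ) * ρ := by group
    _ = ρ * ρ * (σ * ρ) := by rw [hT.sigma_rho, mul_assoc, hT.sigma_rho]
    _ = ρ * (ρ * ρ) * (ρ * σ) := by rw [hT.sigma_rho]; group
    _ = ρ * σ := by rw [h2, one_mul]

theorem rho_rho_rho_apply (hT : IsGroupWithTriality G S σ ρ) (g : G) : ρ (ρ (ρ g)) = g :=
  DFunLike.congr_fun hT.rho_rho_rho g

theorem sigma_rho_apply (hT : IsGroupWithTriality G S σ ρ) (g : G) : σ (ρ g) = ρ (ρ (σ g)) :=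
  DFunLike.congr_fun hT.sigma_rho g

theorem sigma_rho_rho_apply (hT : IsGroupWithTriality G S σ ρ) (g : G) :
    σ (ρ (ρ g)) = ρ (σ g) :=
  DFunLike.congr_fun hT.sigma_rho_rho g

theorem sigma_sigma_smul (hT : IsGroupWithTriality G S σ ρ) (N : Subgroup G) :
    σ • σ • N = N := by rw [smul_smul, hT.sigma_sigma, one_smul]

theorem rho_rho_rho_smul (hT : IsGroupWithTriality G S σ ρ) (N : Subgroup G) :
    ρ • ρ • ρ • N = N := by rw [smul_smul, smul_smul, mul_assoc, hT.rho_rho_rho, one_smul]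

theorem sigma_rho_smul (hT : IsGroupWithTriality G S σ ρ) (N : Subgroup G) :
    σ • ρ • N = ρ • ρ • σ • N := by
  simp only [smul_smul, hT.sigma_rho, mul_assoc]

theorem sigma_rho_rho_smul (hT : IsGroupWithTriality G S σ ρ) (N : Subgroup G) :
    σ • ρ • ρ • N = ρ • σ • N := by
  simp only [smul_smul, hT.sigma_rho_rho]

theorem triality' (hT : IsGroupWithTriality G S σ ρ) (g : G) :
    (g⁻¹ * σ g) * ρ (g⁻¹ * σ g) * ρ (ρ (g⁻¹ * σ g)) = 1 := by
  have := hT.triality g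
  rwa [sq] at this

theorem eq_bot_or_eq_top (hT : IsGroupWithTriality G S σ ρ) (hS : IsSSimple G S)
    {N : Subgroup G} (hN : N.Normal) (hσ : σ • N = N) (hρ : ρ • N = N) : N = ⊥ ∨ N = ⊤ := by
  refine hS N hN fun s hs n hn => ?_
  have h : S ≤ MulAction.stabilizer (MulAut G) N := by
    rw [← hT.closure_eq, Subgroup.closure_le]
    rintro _ (rfl | rfl)
    · exact hσ
    · exact hρ
  have h2 : s • N = N := h hs
  rw [← h2]
  exact Subgroup.apply_mem_smul s hn

theorem center_eq_bot (hS : IsSSimple G S) (hG : ¬ ∀ x y : G, x * y = y * x) :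
    Subgroup.center G = ⊥ := by
  refine (hS (Subgroup.center G) inferInstance fun s _ n hn => ?_).resolve_right fun h => hG ?_
  · rw [Subgroup.mem_center_iff] at hn ⊢
    intro g
    obtain ⟨x, rfl⟩ := s.surjective g
    rw [← map_mul, ← map_mul, hn]
  · intro x y
    have : y ∈ Subgroup.center G := by rw [h]; trivial
    exact Subgroup.mem_center_iff.1 this x

/-! ### Excluding a `ρ`-invariant factor: splitting automorphisms of order three -/

/-- If `G` is the direct product of a `ρ`-invariant normal subgroup `N` and its `σ`-conjugate,
then `ρ` is a splitting automorphism of `N`. -/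
theorem mul_rho_mul_rho_rho_eq_one (hT : IsGroupWithTriality G S σ ρ) {N : Subgroup G}
    (hN : N.Normal) (hρ : ρ • N = N) (hd : N ⊓ σ • N = ⊥) {g : G} (hg : g ∈ N) :
    g * ρ g * ρ (ρ g) = 1 := by
  have hρm : ∀ {x}, x ∈ N → ρ x ∈ N := fun hx => hρ ▸ Subgroup.apply_mem_smul ρ hx
  have hρσ : ρ • σ • N = σ • N := by rw [← hT.sigma_rho_rho_smul, hρ, hρ]
  have hρm' : ∀ {x}, x ∈ σ • N → ρ x ∈ σ • N := fun hx => by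
    rw [← hρσ]; exact Subgroup.apply_mem_smul ρ hx
  have hσN := Subgroup.smul_normal_of_mulAut σ hN
  have hc : ∀ {a b}, a ∈ N → b ∈ σ • N → a * b = b * a := fun ha hb =>
    (Subgroup.commute_of_normal_of_inf_eq_bot hN hσN hd ha hb).eq
  have hi := N.inv_mem hg
  have hs : σ g⁻¹ ∈ σ • N := Subgroup.apply_mem_smul σ hi
  -- Taking `g⁻¹` makes the `N`-parts of the three factors exactly `g`, `ρ g`, `ρ (ρ g)`.
  have ht := hT.triality' g⁻¹
  rw [inv_inv] at ht
  simp only [map_mul] at ht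
  refine Subgroup.eq_one_of_mul_eq_one_of_inf_eq_bot hd
    (b := σ g⁻¹ * ρ (σ g⁻¹) * ρ (ρ (σ g⁻¹)))
    (mul_mem (mul_mem hg (hρm hg)) (hρm (hρm hg)))
    (mul_mem (mul_mem hs (hρm' hs)) (hρm' (hρm' hs))) ?_
  have e1 := hc (hρm hg) hs
  have e2 := hc (hρm (hρm hg)) (mul_mem hs (hρm' hs))
  calc g * ρ g * ρ (ρ g) * (σ g⁻¹ * ρ (σ g⁻¹) * ρ (ρ (σ g⁻¹)))
      = g * ρ g * (ρ (ρ g) * (σ g⁻¹ * ρ (σ g⁻¹))) * ρ (ρ (σ g⁻¹)) := by simp only [mul_assoc]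
    _ = g * (ρ g * σ g⁻¹) * ρ (σ g⁻¹) * ρ (ρ g) * ρ (ρ (σ g⁻¹)) := by
        rw [e2]; simp only [mul_assoc]
    _ = 1 := by rw [e1]; simpa only [mul_assoc] using ht

/-- A group with a splitting automorphism `ρ` of order three: every element commutes with all
conjugates of its images under `⟨ρ⟩`. -/
theorem commute_conj_of_splitting (hT : IsGroupWithTriality G S σ ρ) {N : Subgroup G}
    (hρ : ρ • N = N) (h : ∀ g ∈ N, g * ρ g * ρ (ρ g) = 1) {g x : G} (hg : g ∈ N) (hx : x ∈ N) :
    Commute g (x * g * x⁻¹) ∧ Commute g (x * ρ g * x⁻¹) ∧ Commute g (x * ρ (ρ g) * x⁻¹) := by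
  have hρm : ∀ {x}, x ∈ N → ρ x ∈ N := fun hx => hρ ▸ Subgroup.apply_mem_smul ρ hx
  -- The splitting identity for `g * x`, with `ρ (ρ x)` replaced by `(x * ρ x)⁻¹`.
  have key : ∀ {g x}, g ∈ N → x ∈ N →
      g * (x * ρ g * x⁻¹) * (x * ρ x * ρ (ρ g) * (x * ρ x)⁻¹) = 1 := by
    intro g x hg hx
    have h1 := h _ (mul_mem hg hx)
    have h2 : (x * ρ x)⁻¹ = ρ (ρ x) := inv_eq_of_mul_eq_one_right (h x hx)
    rw [h2, ← h1]
    simp only [map_mul]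
    group
  have hone : ∀ {g x}, g ∈ N → x ∈ N → Commute g (x * ρ g * x⁻¹) := by
    intro g x hg hx
    have h1 := key hg hx
    -- For `g` and `g⁻¹` the third factors are mutually inverse; eliminating them leaves `g⁻¹ * b⁻¹
    -- = (g * b)⁻¹`.
    have h2 := key (N.inv_mem hg) hx
    generalize hb : x * ρ g * x⁻¹ = b at h1 ⊢
    have e1 : x * ρ g⁻¹ * x⁻¹ = b⁻¹ := by rw [← hb, map_inv]; group
    have e2 : x * ρ x * ρ (ρ g⁻¹) * (x * ρ x)⁻¹ = (x * ρ x * ρ (ρ g) * (x * ρ x)⁻¹)⁻¹ := by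
      rw [map_inv, map_inv]; group
    rw [e1, e2, inv_eq_of_mul_eq_one_right h1 |>.symm, inv_inv] at h2
    have h3 : g⁻¹ * b⁻¹ = (g * b)⁻¹ := eq_inv_of_mul_eq_one_left h2
    rw [mul_inv_rev] at h3
    exact Commute.inv_inv_iff.1 h3
  have htwo : ∀ {g x}, g ∈ N → x ∈ N → Commute g (x * ρ (ρ g) * x⁻¹) := by
    intro g x hg hx
    have h1 := hone (hρm (hρm hg)) (N.inv_mem hx)
    rw [hT.rho_rho_rho_apply] at h1
    have h2 := h1.map (MulAut.conj x)
    simp only [MulAut.conj_apply] at h2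
    have e : x * (x⁻¹ * g * x⁻¹⁻¹) * x⁻¹ = g := by group
    rw [e] at h2
    exact h2.symm
  refine ⟨?_, hone hg hx, htwo hg hx⟩
  have h1 := ((hone hg hx).mul_right (htwo hg hx)).inv_right
  have e : (x * ρ g * x⁻¹ * (x * ρ (ρ g) * x⁻¹))⁻¹ = x * (ρ g * ρ (ρ g))⁻¹ * x⁻¹ := by group
  have e2 : (ρ g * ρ (ρ g))⁻¹ = g := by
    rw [inv_eq_iff_eq_inv]
    exact eq_inv_of_mul_eq_one_right (by rw [← mul_assoc]; exact h g hg)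
  rwa [e, e2] at h1

/-- The normal closure `W` of the `ρ`-orbit of some `g ≠ 1` in `N` centralizes `g`, and so does `σW
≤ σN`. But `W ⊔ σW` is `S`-invariant, hence all of `G`, so `g` is central. -/
theorem not_isCompl_of_rho_invariant (hT : IsGroupWithTriality G S σ ρ) (hS : IsSSimple G S)
    (hZ : Subgroup.center G = ⊥) {N : Subgroup G} (hN : N.Normal) (hbot : N ≠ ⊥)
    (hρ : ρ • N = N) (hd : N ⊓ σ • N = ⊥) (hsup : N ⊔ σ • N = ⊤) : False := by
  have hρm : ∀ {x}, x ∈ N → ρ x ∈ N := fun hx => hρ ▸ Subgroup.apply_mem_smul ρ hx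
  have hσN := Subgroup.smul_normal_of_mulAut σ hN
  have hsplit := fun g (hg : g ∈ N) => hT.mul_rho_mul_rho_rho_eq_one hN hρ hd hg
  obtain ⟨g, hg, hg1⟩ := (Subgroup.bot_or_exists_ne_one N).resolve_left hbot
  set X : Set G := {g, ρ g, ρ (ρ g)} with hX
  set W := Subgroup.normalClosure X with hW
  have hXN : X ⊆ N := by
    rintro _ (rfl | rfl | rfl)
    exacts [hg, hρm hg, hρm (hρm hg)]
  have hWN : W ≤ N := Subgroup.normalClosure_le_normal hXN
  have hWn : W.Normal := Subgroup.normalClosure_normal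
  have hgW : g ∈ W := Subgroup.subset_normalClosure (by simp [hX])
  have hρX : ∀ x ∈ X, ρ x ∈ X := by
    rintro _ (rfl | rfl | rfl)
    · simp [hX]
    · simp [hX]
    · rw [hT.rho_rho_rho_apply]; simp [hX]
  have hWρ' : W ≤ ρ⁻¹ • W := by
    have := Subgroup.smul_normal_of_mulAut ρ⁻¹ hWn
    refine Subgroup.normalClosure_le_normal fun x hx => ?_
    exact Subgroup.mem_inv_pointwise_smul_iff.2 (Subgroup.subset_normalClosure (hρX x hx))
  have hWρle : ρ • W ≤ W := Subgroup.pointwise_smul_subset_iff.2 hWρ'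
  have hWρ : ρ • W = W := by
    refine le_antisymm hWρle ?_
    calc W = ρ • ρ • ρ • W := (hT.rho_rho_rho_smul W).symm
      _ ≤ ρ • ρ • W := by
        exact Subgroup.pointwise_smul_le_pointwise_smul_iff.2
          (Subgroup.pointwise_smul_le_pointwise_smul_iff.2 hWρle)
      _ ≤ ρ • W := Subgroup.pointwise_smul_le_pointwise_smul_iff.2 hWρle
  have hcomm : ∀ y : G, ∀ x ∈ X, Commute g (y * x * y⁻¹) := by
    intro y x hx
    have hy : y ∈ N ⊔ σ • N := by rw [hsup]; trivial
    -- The `σN`-component of `y` commutes with `x`, so conjugating by its `N`-component suffices.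
    obtain ⟨n, hn, m, hm, rfl⟩ := Subgroup.mem_sup_of_normal_left.1 hy
    have hmx := Subgroup.commute_of_normal_of_inf_eq_bot hN hσN hd (hXN hx) hm
    have e : n * m * x * (n * m)⁻¹ = n * x * n⁻¹ := by
      rw [mul_assoc n m x, ← hmx.eq]; group
    rw [e]
    obtain ⟨h1, h2, h3⟩ := hT.commute_conj_of_splitting hρ hsplit hg hn
    rcases hx with rfl | rfl | rfl
    exacts [h1, h2, h3]
  have hWc : W ≤ Subgroup.centralizer {g} := by
    refine (Subgroup.closure_le _).2 fun z hz => ?_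
    obtain ⟨x, hx, hxz⟩ := Group.mem_conjugatesOfSet_iff.1 hz
    obtain ⟨y, rfl⟩ := isConj_iff.1 hxz
    exact Subgroup.mem_centralizer_singleton_iff.2 (hcomm y x hx).eq.symm
  have hσW := Subgroup.smul_normal_of_mulAut σ hWn
  have hV : W ⊔ σ • W = ⊤ := by
    refine (hT.eq_bot_or_eq_top hS (N := W ⊔ σ • W) inferInstance ?_ ?_).resolve_left ?_
    · rw [Subgroup.smul_sup, hT.sigma_sigma_smul, sup_comm]
    · rw [Subgroup.smul_sup, ← hT.sigma_rho_rho_smul, hWρ, hWρ]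
    · intro h
      have : g ∈ W ⊔ σ • W := le_sup_left (α := Subgroup G) hgW
      rw [h] at this
      exact hg1 (Subgroup.mem_bot.1 this)
  refine hg1 (Subgroup.eq_one_of_commute_of_sup_eq_top hZ hV
    (fun a ha => (Subgroup.mem_centralizer_singleton_iff.1 (hWc ha)).symm)
    fun b hb => Subgroup.commute_of_normal_of_inf_eq_bot hN hσN hd hg ?_)
  exact Subgroup.pointwise_smul_le_pointwise_smul_iff.2 hWN hb

/-! ### Finding a `σ`-invariant normal subgroup disjoint from its `ρ`-image -/

theorem exists_sigma_invariant (hT : IsGroupWithTriality G S σ ρ) (hS : IsSSimple G S)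
    (hZ : Subgroup.center G = ⊥) {N : Subgroup G} (hN : N.Normal) (hbot : N ≠ ⊥)
    (htop : N ≠ ⊤) : ∃ L : Subgroup G, L.Normal ∧ L ≠ ⊥ ∧ L ≠ ⊤ ∧ σ • L = L := by
  by_contra! hno
  have aux : ∀ P : Subgroup G, P.Normal → P ≠ ⊥ → P ≠ ⊤ →
      P ⊓ σ • P = ⊥ ∧ P ⊔ σ • P = ⊤ := by
    intro P hP hb ht
    have hσP := Subgroup.smul_normal_of_mulAut σ hP
    constructor
    · by_contra h
      refine hno _ (inferInstance : (P ⊓ σ • P).Normal) h (fun h' => ht ?_) ?_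
      · exact top_le_iff.1 (h' ▸ inf_le_left)
      · rw [Subgroup.smul_inf, hT.sigma_sigma_smul, inf_comm]
    · by_contra h
      refine hno _ (inferInstance : (P ⊔ σ • P).Normal) (fun h' => hb ?_) h ?_
      · exact le_bot_iff.1 (h' ▸ le_sup_left)
      · rw [Subgroup.smul_sup, hT.sigma_sigma_smul, sup_comm]
  obtain ⟨hd, hsup⟩ := aux N hN hbot htop
  have hρN := Subgroup.smul_normal_of_mulAut ρ hN
  have hσN := Subgroup.smul_normal_of_mulAut σ hN
  have hρσN := Subgroup.smul_normal_of_mulAut ρ hσN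
  have hbot' : ρ • N ≠ ⊥ := fun h => hbot <| by
    rw [← hT.rho_rho_rho_smul N, h, Subgroup.smul_bot, Subgroup.smul_bot]
  have htop' : ρ • N ≠ ⊤ := fun h => htop <| by
    rw [← inv_smul_smul ρ N, h]
    exact top_le_iff.1 fun x _ => Subgroup.mem_inv_pointwise_smul_iff.2 trivial
  have hd' : N ⊓ ρ • σ • N = ⊥ := by
    have h := (aux _ hρN hbot' htop').1
    rw [hT.sigma_rho_smul, ← Subgroup.smul_inf] at h
    rw [← inv_smul_smul ρ (N ⊓ ρ • σ • N), h, Subgroup.smul_bot]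
  have hle : ρ • σ • N ≤ σ • N := by
    intro x hx
    have hx' : x ∈ N ⊔ σ • N := by rw [hsup]; trivial
    -- Both `n * m` and `m` centralize `N`, hence so does `n`; it also centralizes `σN`, so it is
    -- central.
    obtain ⟨n, hn, m, hm, rfl⟩ := Subgroup.mem_sup_of_normal_left.1 hx'
    have hn1 : n = 1 := by
      refine Subgroup.eq_one_of_commute_of_sup_eq_top hZ hsup (fun a ha => ?_) fun b hb =>
        Subgroup.commute_of_normal_of_inf_eq_bot hN hσN hd hn hb
      have h1 := Subgroup.commute_of_normal_of_inf_eq_bot hN hρσN hd' ha hx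
      have h2 := Subgroup.commute_of_normal_of_inf_eq_bot hN hσN hd ha hm
      have h3 := h1.mul_right h2.inv_right
      rw [mul_inv_cancel_right] at h3
      exact h3.symm
    rwa [hn1, one_mul]
  have heq : ρ • ρ • σ • N = σ • N := by
    have h2 := Subgroup.pointwise_smul_le_pointwise_smul_iff (a := ρ).2 hle
    refine le_antisymm (h2.trans hle) ?_
    calc σ • N = ρ • ρ • ρ • σ • N := (hT.rho_rho_rho_smul _).symm
      _ ≤ ρ • ρ • σ • N := Subgroup.pointwise_smul_le_pointwise_smul_iff.2 h2
  have hρ : ρ • N = N := by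
    rw [← hT.sigma_sigma_smul (ρ • N), hT.sigma_rho_smul, heq, hT.sigma_sigma_smul]
  exact hT.not_isCompl_of_rho_invariant hS hZ hN hbot hρ hd hsup

/-- If `L` itself fails, `M = ρL ∩ ρ²L` works: it is `σ`-invariant, and `M ∩ ρM = L ∩ ρL ∩ ρ²L` is
`S`-invariant and proper, hence trivial. -/
theorem exists_sigma_invariant_disjoint (hT : IsGroupWithTriality G S σ ρ) (hS : IsSSimple G S)
    (hZ : Subgroup.center G = ⊥) {N : Subgroup G} (hN : N.Normal) (hbot : N ≠ ⊥)
    (htop : N ≠ ⊤) :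
    ∃ L : Subgroup G, L.Normal ∧ L ≠ ⊥ ∧ σ • L = L ∧ L ⊓ ρ • L = ⊥ := by
  obtain ⟨L, hL, hb, ht, hσ⟩ := hT.exists_sigma_invariant hS hZ hN hbot htop
  have hL1 := Subgroup.smul_normal_of_mulAut ρ hL
  have hL2 := Subgroup.smul_normal_of_mulAut ρ hL1
  have hσ1 : σ • ρ • L = ρ • ρ • L := by rw [hT.sigma_rho_smul, hσ]
  have hσ2 : σ • ρ • ρ • L = ρ • L := by rw [hT.sigma_rho_rho_smul, hσ]
  by_cases hM : ρ • L ⊓ ρ • ρ • L = ⊥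
  · refine ⟨L, hL, hb, hσ, ?_⟩
    rw [← Subgroup.smul_inf] at hM
    rw [← inv_smul_smul ρ (L ⊓ ρ • L), hM, Subgroup.smul_bot]
  · refine ⟨ρ • L ⊓ ρ • ρ • L, inferInstance, hM, ?_, ?_⟩
    · rw [Subgroup.smul_inf, hσ1, hσ2, inf_comm]
    · have e : ρ • L ⊓ ρ • ρ • L ⊓ ρ • (ρ • L ⊓ ρ • ρ • L) = L ⊓ (ρ • L ⊓ ρ • ρ • L) := by
        rw [Subgroup.smul_inf, hT.rho_rho_rho_smul]
        refine le_antisymm (le_inf (inf_le_right.trans inf_le_right) inf_le_left)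
          (le_inf inf_le_right (le_inf (inf_le_right.trans inf_le_right) inf_le_left))
      rw [e]
      refine (hT.eq_bot_or_eq_top hS inferInstance ?_ ?_).resolve_right fun h =>
        ht (top_le_iff.1 (h ▸ inf_le_left))
      · rw [Subgroup.smul_inf, Subgroup.smul_inf, hσ, hσ1, hσ2, inf_comm (ρ • L)]
      · rw [Subgroup.smul_inf, Subgroup.smul_inf, hT.rho_rho_rho_smul, ← inf_assoc, inf_comm]

/-! ### The decomposition into three copies of a simple group -/

/-- The join of the `ρ`-conjugates of a nontrivial `σ`-invariant normal subgroup is everything. -/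
theorem sup_rho_eq_top (hT : IsGroupWithTriality G S σ ρ) (hS : IsSSimple G S)
    {K : Subgroup G} (hK : K.Normal) (hbot : K ≠ ⊥) (hσ : σ • K = K) :
    K ⊔ (ρ • K ⊔ ρ • ρ • K) = ⊤ := by
  have hK1 := Subgroup.smul_normal_of_mulAut ρ hK
  have hK2 := Subgroup.smul_normal_of_mulAut ρ hK1
  refine (hT.eq_bot_or_eq_top hS inferInstance ?_ ?_).resolve_left fun h =>
    hbot (le_bot_iff.1 (h ▸ le_sup_left))
  · rw [Subgroup.smul_sup, Subgroup.smul_sup, hT.sigma_rho_rho_smul, hT.sigma_rho_smul, hσ,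
      sup_comm (ρ • K)]
  · rw [Subgroup.smul_sup, Subgroup.smul_sup, hT.rho_rho_rho_smul, ← sup_assoc, sup_comm]

/-- The isomorphism is `(a, b, c) ↦ a · ρ b · ρ² c`. As `σ` fixes `L` pointwise, it merely exchanges
`ρ b` with `ρ² b`. -/
theorem exists_mulEquiv_of_disjoint (hT : IsGroupWithTriality G S σ ρ) (hS : IsSSimple G S)
    (hZ : Subgroup.center G = ⊥) {L : Subgroup G} (hL : L.Normal) (hbot : L ≠ ⊥)
    (hσ : σ • L = L) (hd : L ⊓ ρ • L = ⊥) :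
    IsSimpleGroup L ∧ ∃ e : L × L × L ≃* G, ∀ a b c : L,
      ρ (e (a, b, c)) = e (c, a, b) ∧ σ (e (a, b, c)) = e (a, c, b) := by
  have hL1 := Subgroup.smul_normal_of_mulAut ρ hL
  have hL2 := Subgroup.smul_normal_of_mulAut ρ hL1
  have htop := hT.sup_rho_eq_top hS hL hbot hσ
  have hd12 : ρ • L ⊓ ρ • ρ • L = ⊥ := by rw [← Subgroup.smul_inf, hd, Subgroup.smul_bot]
  have hd2 : L ⊓ ρ • ρ • L = ⊥ := by
    have h : ρ • ρ • L ⊓ ρ • ρ • ρ • L = ⊥ := by rw [← Subgroup.smul_inf, hd12, Subgroup.smul_bot]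
    rwa [hT.rho_rho_rho_smul, inf_comm] at h
  have m1 : ∀ {x}, x ∈ L → ρ x ∈ ρ • L := fun hx => Subgroup.apply_mem_smul ρ hx
  have m2 : ∀ {x}, x ∈ L → ρ (ρ x) ∈ ρ • ρ • L := fun hx => Subgroup.apply_mem_smul ρ (m1 hx)
  have hcomm : ∀ a ∈ L, ∀ b ∈ ρ • L ⊔ ρ • ρ • L, Commute a b := by
    intro a ha b hb
    obtain ⟨u, hu, v, hv, rfl⟩ := Subgroup.mem_sup_of_normal_left.1 hb
    exact (Subgroup.commute_of_normal_of_inf_eq_bot hL hL1 hd ha hu).mul_right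
      (Subgroup.commute_of_normal_of_inf_eq_bot hL hL2 hd2 ha hv)
  have hdis : L ⊓ (ρ • L ⊔ ρ • ρ • L) = ⊥ := by
    refine (Subgroup.eq_bot_iff_forall _).2 fun x hx => ?_
    exact Subgroup.eq_one_of_commute_of_sup_eq_top hZ htop
      (fun a ha => (hcomm a ha x hx.2).symm) (fun b hb => hcomm x hx.1 b hb)
  have hfix : ∀ x ∈ L, σ x = x := by
    intro x hx
    -- `[x,σ]` lies in `L` and the other two triality factors in `ρL ⊔ ρ²L`, so each part is
    -- trivial.
    have hx1 : x⁻¹ * σ x ∈ L := mul_mem (L.inv_mem hx) (hσ ▸ Subgroup.apply_mem_smul σ hx)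
    have h := hT.triality' x
    rw [mul_assoc] at h
    have := Subgroup.eq_one_of_mul_eq_one_of_inf_eq_bot hdis hx1
      (Subgroup.mul_mem_sup (m1 hx1) (m2 hx1)) h
    exact (inv_mul_eq_one.1 this).symm
  refine ⟨?_, ?_⟩
  · have hnt : Nontrivial L := (Subgroup.nontrivial_iff_ne_bot L).2 hbot
    refine ⟨fun K hK => or_iff_not_imp_left.2 fun hKb => ?_⟩
    have hK'L : K.map L.subtype ≤ L := Subgroup.map_subtype_le K
    have hK'n : (K.map L.subtype).Normal := by
      refine ⟨?_⟩
      rintro _ ⟨k, hk, rfl⟩ y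
      have hy : y ∈ L ⊔ (ρ • L ⊔ ρ • ρ • L) := by rw [htop]; trivial
      obtain ⟨l, hl, m, hm, rfl⟩ := Subgroup.mem_sup_of_normal_left.1 hy
      -- The other two factors of `G` centralize `L`, so conjugation by `l` is all that matters.
      refine ⟨⟨l, hl⟩ * k * ⟨l, hl⟩⁻¹, hK.conj_mem k hk _, ?_⟩
      have e := (hcomm k k.2 m hm).eq
      simp only [Subgroup.subtype_apply, Subgroup.coe_mul, Subgroup.coe_inv]
      rw [mul_assoc l m, ← e]
      group
    have hK'b : K.map L.subtype ≠ ⊥ := fun h =>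
      hKb ((Subgroup.map_eq_bot_iff_of_injective K L.subtype_injective).1 h)
    have hσle : ∀ x ∈ K.map L.subtype, x ∈ σ • K.map L.subtype := fun x hx => by
      have := Subgroup.apply_mem_smul σ hx
      rwa [hfix x (hK'L hx)] at this
    have hK'σ : σ • K.map L.subtype = K.map L.subtype := by
      refine le_antisymm ?_ hσle
      have := Subgroup.pointwise_smul_le_pointwise_smul_iff (a := σ).2 hσle
      rwa [hT.sigma_sigma_smul] at this
    have hK't := hT.sup_rho_eq_top hS hK'n hK'b hK'σ
    refine top_le_iff.1 fun x _ => ?_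
    have hx : (x : G) ∈ K.map L.subtype ⊔
        (ρ • K.map L.subtype ⊔ ρ • ρ • K.map L.subtype) := by rw [hK't]; trivial
    obtain ⟨k, hk, m, hm, hkm⟩ := Subgroup.mem_sup_of_normal_left.1 hx
    have hm' : m ∈ ρ • L ⊔ ρ • ρ • L := by
      have h1 := Subgroup.pointwise_smul_le_pointwise_smul_iff (a := ρ).2 hK'L
      exact sup_le_sup h1 (Subgroup.pointwise_smul_le_pointwise_smul_iff.2 h1) hm
    -- Compare the `L`-components of `x = k * m`.
    have hk1 : (x : G)⁻¹ * k = 1 := by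
      refine Subgroup.eq_one_of_mul_eq_one_of_inf_eq_bot hdis
        (mul_mem (L.inv_mem x.2) (hK'L hk)) hm' ?_
      rw [mul_assoc, hkm, inv_mul_cancel]
    rw [← inv_mul_eq_one.1 hk1] at hk
    obtain ⟨y, hy, hyx⟩ := hk
    rwa [← Subtype.ext (a1 := y) (a2 := x) hyx]
  · let f : L × L × L →* G := MonoidHom.mk' (fun p => p.1 * (ρ p.2.1 * ρ (ρ p.2.2))) <| by
      rintro ⟨a, b, c⟩ ⟨a', b', c'⟩
      have e1 := (hcomm a' a'.2 _ (Subgroup.mul_mem_sup (m1 b.2) (m2 c.2))).eq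
      have e2 := (Subgroup.commute_of_normal_of_inf_eq_bot hL1 hL2 hd12 (m1 b'.2) (m2 c.2)).eq
      simp only [Prod.mk_mul_mk, Subgroup.coe_mul, map_mul]
      calc (a : G) * a' * (ρ b * ρ b' * (ρ (ρ c) * ρ (ρ c')))
          = a * a' * (ρ b * (ρ b' * ρ (ρ c)) * ρ (ρ c')) := by simp only [mul_assoc]
        _ = a * (a' * (ρ b * ρ (ρ c))) * (ρ b' * ρ (ρ c')) := by
          rw [e2]; simp only [mul_assoc]
        _ = a * (ρ b * ρ (ρ c)) * (a' * (ρ b' * ρ (ρ c'))) := by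
          rw [e1]; simp only [mul_assoc]
    have hf : ∀ a b c : L, f (a, b, c) = a * (ρ b * ρ (ρ c)) := fun _ _ _ => rfl
    have hinj : Function.Injective f := by
      refine (injective_iff_map_eq_one f).2 ?_
      rintro ⟨a, b, c⟩ h
      rw [hf] at h
      have ha := Subgroup.eq_one_of_mul_eq_one_of_inf_eq_bot hdis a.2
        (Subgroup.mul_mem_sup (m1 b.2) (m2 c.2)) h
      rw [ha, one_mul] at h
      have hb := Subgroup.eq_one_of_mul_eq_one_of_inf_eq_bot hd12 (m1 b.2) (m2 c.2) h
      rw [hb, one_mul] at h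
      simp only [EmbeddingLike.map_eq_one_iff] at hb h
      exact Prod.ext (Subtype.ext ha) (Prod.ext (Subtype.ext hb) (Subtype.ext h))
    have hsurj : Function.Surjective f := by
      intro y
      have hy : y ∈ L ⊔ (ρ • L ⊔ ρ • ρ • L) := by rw [htop]; trivial
      obtain ⟨a, ha, m, hm, rfl⟩ := Subgroup.mem_sup_of_normal_left.1 hy
      obtain ⟨_, ⟨b, hb, rfl⟩, _, ⟨_, ⟨c, hc, rfl⟩, rfl⟩, rfl⟩ :=
        Subgroup.mem_sup_of_normal_left.1 hm
      exact ⟨(⟨a, ha⟩, ⟨b, hb⟩, ⟨c, hc⟩), rfl⟩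
    have hbij : Function.Bijective f := ⟨hinj, hsurj⟩
    refine ⟨MulEquiv.ofBijective f hbij, fun a b c => ?_⟩
    simp only [MulEquiv.ofBijective_apply, hf, map_mul]
    constructor
    · rw [hT.rho_rho_rho_apply, ← mul_assoc]
      exact (hcomm c c.2 _ (Subgroup.mul_mem_sup (m1 a.2) (m2 b.2))).eq.symm
    · rw [hT.sigma_rho_apply, hT.sigma_rho_rho_apply, hfix a a.2, hfix b b.2, hfix c c.2,
        (Subgroup.commute_of_normal_of_inf_eq_bot hL1 hL2 hd12 (m1 c.2) (m2 b.2)).eq]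

end IsGroupWithTriality

end

theorem mainTheorem5 (G : Type u) [Group G] (S : Subgroup (MulAut G)) (σ ρ : MulAut G)
    (hT : IsGroupWithTriality G S σ ρ) (hS : IsSSimple G S)
    (hG : ¬ ∀ x y : G, x * y = y * x) :
    IsSimpleGroup G ∨
      ∃ (A : Type u) (_ : Group A), IsSimpleGroup A ∧
        ∃ e : A × A × A ≃* G, ∀ a b c : A,
          ρ (e (a, b, c)) = e (c, a, b) ∧ σ (e (a, b, c)) = e (a, c, b) := by
  have hZ := IsGroupWithTriality.center_eq_bot hS hG
  by_cases hsimple : ∀ N : Subgroup G, N.Normal → N = ⊥ ∨ N = ⊤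
  · left
    have : Nontrivial G := by
      by_contra h
      rw [not_nontrivial_iff_subsingleton] at h
      exact hG fun x y => Subsingleton.elim _ _
    exact ⟨hsimple⟩
  · right
    push Not at hsimple
    obtain ⟨N, hN, hbot, htop⟩ := hsimple
    obtain ⟨L, hL, hLb, hσ, hd⟩ := hT.exists_sigma_invariant_disjoint hS hZ hN hbot htop
    obtain ⟨h1, h2⟩ := hT.exists_mulEquiv_of_disjoint hS hZ hL hLb hσ hd
    exact ⟨L, inferInstance, h1, h2⟩
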